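/- **Theorem (Strong convexity of $g$).** Let $\mathcal H_1,\mathcal H_2,\mathcal G$ be real Hilbert spaces, let $f:\mathcal H_1\to(-\infty,\infty]$ and $g:\mathcal H_2\to(-\infty,\infty]$ be closed, proper and convex, let $A:\mathcal H_1\to\mathcal G$ and $B:\mathcal H_2\to\mathcal G$ be bounded linear operators with $B\neq0$, and let $b\in\mathcal G$. Suppose that $g$ is $\mu_g$-strongly convex with $\mu_g>0$, put $\beta=\mu_g/\|B\|^2$, let $\kappa\approx1.24698$ be the positive root of $t^3+t^2-2t-1$, and let $0<\gamma<\kappa\beta$. *Dual problem.* Let $d_f(w)=f^*(A^*w)$ and $d_g(w)=g^*(B^*w)-\langle w,b\rangle$ on $\mathcal G$, where $^*$ on functions is the convex conjugate. Write $\mathbf{prox}_{\gamma h}(z)=\operatorname{argmin}_p\{h(p)+\frac1{2\gamma}\|p-z\|^2\}$ and $\mathbf{refl}_{\gamma h}=2\,\mathbf{prox}_{\gamma h}-I$. *Algorithm (standard ADMM, that is, relaxed ADMM with $\lambda_k\equiv1/2$).* Let $z^0\in\mathcal G$, $w^{-1}=z^0$, $x^{-1}=0$, $y^{-1}=0$,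 and let the sequences satisfy, for $k=-1,0,1,\dots$, $$y^{k+1}\in\operatorname{argmin}_y\; g(y)-\langle w^k,Ax^k+By-b\rangle+\tfrac\gamma2\|Ax^k+By-b\|^2,$$ $$w^{k+1}=w^k-\gamma(Ax^k+By^{k+1}-b),$$ $$x^{k+1}\in\operatorname{argmin}_x\; f(x)-\langle w^{k+1},Ax+By^{k+1}-b\rangle+\tfrac\gamma2\|Ax+By^{k+1}-b\|^2 .$$ Put $w_{d_g}^0=\mathbf{prox}_{\gamma d_g}(z^0)$. *Optimal points.* Let $z^*$ be a fixed point of $\mathbf{refl}_{\gamma d_f}\circ\mathbf{refl}_{\gamma d_g}$, let $w^*=\mathbf{prox}_{\gamma d_g}(z^*)$, and let $x^*\in\mathcal H_1$, $y^*\in\mathcal H_2$ satisfy $A^*w^*\in\partial f(x^*)$, $B^*w^*\in\partial g(y^*)$, $Ax^*=\frac1\gamma(\mathbf{refl}_{\gamma d_g}(z^*)-w^*)$ and $By^*-b=\frac1\gamma(z^*-w^*)$. Then for all $k\ge1$ $$\|Ax^k+By^k-b\|^2\le\frac{\beta^2(1+\gamma/\beta)^2\,\|w_{d_g}^0-w^*\|^2}{\gamma^2k^2\,(\beta^2-\gamma^2/\kappa^2)},$$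 and $\|Ax^k+By^k-b\|^2=o(1/k^2)$ as $k\to\infty$. Moreover $f(x^k)$ and $g(y^k)$ are finite for all $k\ge 0$, for all $k\ge1$ $$\frac{-\beta(1+\gamma/\beta)\,\|w^*\|\,\|w_{d_g}^0-w^*\|}{\gamma k\sqrt{\beta^2-\gamma^2/\kappa^2}}\le f(x^k)+g(y^k)-f(x^*)-g(y^*)\le\frac{\beta(1+\gamma/\beta)\,\|w_{d_g}^0-w^*\|\,\bigl(\|z^0-z^*\|+\|w^*\|\bigr)}{\gamma k\sqrt{\beta^2-\gamma^2/\kappa^2}},$$ and $|f(x^k)+g(y^k)-f(x^*)-g(y^*)|=o(1/k)$ as $k\to\infty$. -/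

import Mathlib

open Filter Topology Asymptotics
open scoped InnerProductSpace

noncomputable section

namespace DualSplitting

/-- Convexity with modulus `μ` of an extended-real-valued function:
`f (a x + b y) + (μ / 2) a b ‖x - y‖² ≤ a f x + b f y`.  For `μ > 0` this is `μ`-strong convexity,
for `μ = 0` it is convexity. -/
def ConvexModulus {H : Type*} [NormedAddCommGroup H] [InnerProductSpace ℝ H]
    (μ : ℝ) (f : H → EReal) : Prop :=
  ∀ (x y : H) (a b : ℝ), 0 ≤ a → 0 ≤ b → a + b = 1 →
    f (a • x + b • y) + ((μ / 2 * (a * b) * ‖x - y‖ ^ 2 : ℝ) : EReal)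
      ≤ (a : EReal) * f x + (b : EReal) * f y

/-- Closed (lower semicontinuous), proper and convex functions `H → (-∞, ∞]`. -/
structure ClosedProperConvex {H : Type*} [NormedAddCommGroup H] [InnerProductSpace ℝ H]
    (f : H → EReal) : Prop where
  ne_bot : ∀ x, f x ≠ ⊥
  proper : ∃ x, f x ≠ ⊤
  closed : LowerSemicontinuous f
  convex : ConvexModulus 0 f

/-- The subdifferential of `f` at `x`; it is empty where `f` is not finite. -/
def subdifferential {H : Type*} [NormedAddCommGroup H] [InnerProductSpace ℝ H]
    (f : H → EReal) (x : H) : Set H :=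
  {u | f x ≠ ⊤ ∧ f x ≠ ⊥ ∧ ∀ y, f x + ((⟪u, y - x⟫_ℝ : ℝ) : EReal) ≤ f y}

/-- The convex conjugate `f* (u) = sup_x ⟨u, x⟩ - f x`. -/
def conjugate {H : Type*} [NormedAddCommGroup H] [InnerProductSpace ℝ H]
    (f : H → EReal) (u : H) : EReal :=
  ⨆ x, (((⟪u, x⟫_ℝ : ℝ) : EReal) - f x)

/-- `prox_{γ h} (z) = argmin_p h p + ‖p - z‖² / (2 γ)`. -/
def prox {H : Type*} [NormedAddCommGroup H] [InnerProductSpace ℝ H]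
    (γ : ℝ) (h : H → EReal) (z : H) : H :=
  Classical.epsilon fun p =>
    IsMinOn (fun q => h q + ((1 / (2 * γ) * ‖q - z‖ ^ 2 : ℝ) : EReal)) Set.univ p

/-- `refl_{γ h} = 2 prox_{γ h} - I`. -/
def refl {H : Type*} [NormedAddCommGroup H] [InnerProductSpace ℝ H]
    (γ : ℝ) (h : H → EReal) (z : H) : H :=
  (2 : ℝ) • prox γ h z - z

/-- The Peaceman-Rachford operator `T = refl_{γ h₁} ∘ refl_{γ h₂}`. -/
def prsOperator {H : Type*} [NormedAddCommGroup H] [InnerProductSpace ℝ H]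
    (γ : ℝ) (h₁ h₂ : H → EReal) : H → H :=
  refl γ h₁ ∘ refl γ h₂

section Admm

variable {H₁ H₂ G : Type*}
  [NormedAddCommGroup H₁] [InnerProductSpace ℝ H₁] [CompleteSpace H₁]
  [NormedAddCommGroup H₂] [InnerProductSpace ℝ H₂] [CompleteSpace H₂]
  [NormedAddCommGroup G] [InnerProductSpace ℝ G] [CompleteSpace G]

/-- The dual function `d_f (w) = f* (A* w)`. -/
def dualF (f : H₁ → EReal) (A : H₁ →L[ℝ] G) (w : G) : EReal :=
  conjugate f (ContinuousLinearMap.adjoint A w)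

/-- The dual function `d_g (w) = g* (B* w) - ⟨w, b⟩`. -/
def dualG (g : H₂ → EReal) (B : H₂ →L[ℝ] G) (b w : G) : EReal :=
  conjugate g (ContinuousLinearMap.adjoint B w) - ((⟪w, b⟫_ℝ : ℝ) : EReal)

/-- One `y`-update: `yNew` minimizes
`g(y) - ⟨w, A x + B y - b⟩ + (γ/2) ‖A x + B y - b + (2 l - 1) (A x + B yOld - b)‖²`. -/
def IsYUpdate (g : H₂ → EReal) (A : H₁ →L[ℝ] G) (B : H₂ →L[ℝ] G) (b : G) (γ l : ℝ)
    (x : H₁) (yOld : H₂) (w : G) (yNew : H₂) : Prop :=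
  IsMinOn (fun y => g y + ((-⟪w, A x + B y - b⟫_ℝ
      + γ / 2 * ‖A x + B y - b + (2 * l - 1) • (A x + B yOld - b)‖ ^ 2 : ℝ) : EReal))
    Set.univ yNew

/-- One `w`-update:
`wNew = w - γ (A x + B yNew - b) - γ (2 l - 1) (A x + B yOld - b)`. -/
def IsWUpdate (A : H₁ →L[ℝ] G) (B : H₂ →L[ℝ] G) (b : G) (γ l : ℝ)
    (x : H₁) (yOld : H₂) (w : G) (yNew : H₂) (wNew : G) : Prop :=
  wNew = w - γ • (A x + B yNew - b) - (γ * (2 * l - 1)) • (A x + B yOld - b)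

/-- One `x`-update: `xNew` minimizes `f(x) - ⟨w, A x + B y - b⟩ + (γ/2) ‖A x + B y - b‖²`. -/
def IsXUpdate (f : H₁ → EReal) (A : H₁ →L[ℝ] G) (B : H₂ →L[ℝ] G) (b : G) (γ : ℝ)
    (y : H₂) (w : G) (xNew : H₁) : Prop :=
  IsMinOn (fun x => f x + ((-⟪w, A x + B y - b⟫_ℝ
      + γ / 2 * ‖A x + B y - b‖ ^ 2 : ℝ) : EReal))
    Set.univ xNew

/-- Relaxed ADMM with relaxation parameters `(l k)`, started at index `-1` from
`w₋₁ = wInit`, `x₋₁ = 0`, `y₋₁ = 0`, `l₋₁ = 1/2`; the sequences hold the iterates of index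
`0, 1, 2, …`. -/
structure IsRelaxedADMM (f : H₁ → EReal) (g : H₂ → EReal) (A : H₁ →L[ℝ] G) (B : H₂ →L[ℝ] G)
    (b : G) (γ : ℝ) (l : ℕ → ℝ) (wInit : G) (x : ℕ → H₁) (y : ℕ → H₂) (w : ℕ → G) : Prop where
  y_zero : IsYUpdate g A B b γ (1 / 2) 0 0 wInit (y 0)
  w_zero : IsWUpdate A B b γ (1 / 2) 0 0 wInit (y 0) (w 0)
  y_succ : ∀ k, IsYUpdate g A B b γ (l k) (x k) (y k) (w k) (y (k + 1))
  w_succ : ∀ k, IsWUpdate A B b γ (l k) (x k) (y k) (w k) (y (k + 1)) (w (k + 1))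
  x_step : ∀ k, IsXUpdate f A B b γ (y k) (w k) (x k)

/-- The optimal points attached to a fixed point `zs` of the Peaceman-Rachford operator of
`(d_f, d_g)`: `ws = prox_{γ d_g} zs`, and `xs`, `ys` are primal points with
`A* ws ∈ ∂f(xs)`, `B* ws ∈ ∂g(ys)` which represent the subgradients of `d_f`, `d_g` at `ws` that the
two proximal steps select, that is `A xs = (refl_{γ d_g} zs - ws) / γ` and
`B ys - b = (zs - ws) / γ`. -/
structure IsOptimalTuple (f : H₁ → EReal) (g : H₂ → EReal) (A : H₁ →L[ℝ] G) (B : H₂ →L[ℝ] G)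
    (b : G) (γ : ℝ) (zs ws : G) (xs : H₁) (ys : H₂) : Prop where
  fixed : Function.IsFixedPt (prsOperator γ (dualF f A) (dualG g B b)) zs
  ws_eq : ws = prox γ (dualG g B b) zs
  subgrad_f : ContinuousLinearMap.adjoint A ws ∈ subdifferential f xs
  subgrad_g : ContinuousLinearMap.adjoint B ws ∈ subdifferential g ys
  dual_subgrad_f : A xs = (1 / γ) • (refl γ (dualG g B b) zs - ws)
  dual_subgrad_g : B ys - b = (1 / γ) • (zs - ws)

/-- The primal objective error `f(x) + g(y) - f(xs) - g(ys)`, for points where all four values are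
finite. -/
def objectiveError (f : H₁ → EReal) (g : H₂ → EReal) (x xs : H₁) (y ys : H₂) : ℝ :=
  (f x).toReal + (g y).toReal - (f xs).toReal - (g ys).toReal

end Admm

end DualSplitting

end

/-!
ADMM is Douglas-Rachford splitting for the dual problem of minimizing `d_f + d_g`: with
`v k = w k - γ (A (x k) + B (y k) - b)`, the optimality conditions of the two subproblems say that
`A (x k)` is a subgradient of `d_f` at `v k` and `B (y k) - b` is a subgradient of `d_g` at `w k`.
Strong convexity of `g` makes `d_g` smooth with a `1 / β`-Lipschitz gradient. After the scaling
`P = γ A x`, `Q = γ (B y - b)`, `t = γ / β`, the iterates satisfy the relations collected in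
`DualSplitting.IsSplittingOrbit`, and the residual `γ (A (x k) + B (y k) - b) = P k + Q k`
is the fixed-point residual of the Douglas-Rachford variable `z k = w k + Q k`.

The rate comes from an energy argument. Since `w (k + 1) = w k - P k - Q (k + 1)`, the step is a
backward step for a model of `d_f + d_g` in which `d_f` is linearized at `v k`. The squared distance
of `w k` to the solution decreases by the optimality gap of this model (`descent`), and the gap
decreases by twice the squared increment of `w` up to error terms (`gap_succ_le`). Summing by parts
gives a bound on a sum of quadratic forms in the increments of `w` and `Q` with weights growing like
`2 k + 1` (`weighted_energy_le`), and cocoercivity of `∇ d_g` makes each of these forms at least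
`(2 k + 1) (1 - t² / κ²) / (1 + t)² ‖P k + Q k‖²` (`weighted_norm_sq_le`). Hence
`∑ (2 k + 1) ‖P k + Q k‖²` is bounded by an explicit multiple of `‖w 0 - ws‖²`. The residuals
decrease because the Douglas-Rachford operator is nonexpansive, so `∑_{k < n} (2 k + 1) = n²` turns
the bound into the explicit `1 / k²` rate, and the vanishing of the tails into `o(1 / k²)`.

The objective error is controlled by the residual: from below by the subgradient inequalities at the
optimal points, from above by those at the iterates together with Fejér monotonicity of `z k`.
-/

namespace DualSplitting

/-! ### Splitting orbits in normalized form -/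

section Hilbert

variable {G : Type*} [NormedAddCommGroup G] [InnerProductSpace ℝ G]

/-- The Douglas-Rachford iteration with the step size absorbed into the dual functions.
Here `P k` and `Q k` are subgradients at `v k` and `w k` of two convex functions with values `Φ k`
and `Ψ k` there, the second function having a `t`-Lipschitz gradient, and `ws` is a minimizer of
their sum with subgradients `-Qs` and `Qs` and values `Φs` and `Ψs`. Only the values and
subgradients at the points that occur are recorded, through the inequalities that relate them: the
subgradient inequality for `Φ`, and for `Ψ` its strengthening `1 / (2 t) ‖Q i - Q j‖²` that
characterizes smooth convex functions. The Douglas-Rachford variable is `w k + Q k`. -/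
structure IsSplittingOrbit (t : ℝ) (w v P Q : ℕ → G) (Φ Ψ : ℕ → ℝ) (ws Qs : G) (Φs Ψs : ℝ) :
    Prop where
  v_eq : ∀ k, v k = w k - P k - Q k
  w_succ : ∀ k, w (k + 1) = w k - P k - Q (k + 1)
  le_Φ : ∀ i j, Φ j + ⟪P j, v i - v j⟫_ℝ ≤ Φ i
  le_Φs : ∀ k, Φ k + ⟪P k, ws - v k⟫_ℝ ≤ Φs
  Φs_le : ∀ k, Φs + ⟪-Qs, v k - ws⟫_ℝ ≤ Φ k
  le_Ψ : ∀ i j, Ψ j + ⟪Q j, w i - w j⟫_ℝ + 1 / (2 * t) * ‖Q i - Q j‖ ^ 2 ≤ Ψ i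
  le_Ψs : ∀ k, Ψ k + ⟪Q k, ws - w k⟫_ℝ + 1 / (2 * t) * ‖Qs - Q k‖ ^ 2 ≤ Ψs
  Ψs_le : ∀ k, Ψs + ⟪Qs, w k - ws⟫_ℝ + 1 / (2 * t) * ‖Q k - Qs‖ ^ 2 ≤ Ψ k

/-- Nonexpansiveness of a Douglas-Rachford step in terms of differences: `d`, `e`, `P` are the
differences of the points `w` and of the two subgradients, `d + e` that of the old and `d - P` that
of the new variable. -/
theorem norm_sq_sub_le_of_monotone {d e P : G} (hde : 0 ≤ ⟪d, e⟫_ℝ)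
    (hP : 0 ≤ ⟪P, d - P - e⟫_ℝ) : ‖d - P‖ ^ 2 ≤ ‖d + e‖ ^ 2 := by
  have h1 : ‖d + e‖ ^ 2 - ‖d - P‖ ^ 2
      = 2 * ⟪d, e⟫_ℝ + ‖e + P‖ ^ 2 + 2 * ⟪P, d - P - e⟫_ℝ := by
    simp only [norm_add_sq_real, norm_sub_sq_real, inner_sub_right, real_inner_self_eq_norm_sq,
      real_inner_comm P]
    ring
  nlinarith [sq_nonneg ‖e + P‖]

theorem inner_nonneg_of_cocoercive {t : ℝ} (ht : 0 < t) {d e : G}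
    (hde : ‖e‖ ^ 2 ≤ t * ⟪d, e⟫_ℝ) : 0 ≤ ⟪d, e⟫_ℝ := by
  by_contra! h
  nlinarith [sq_nonneg ‖e‖, mul_neg_of_pos_of_neg ht h]

/-- The quadratic form that the `k`-th step contributes to the weighted energy dominates
`(2 k + 1) ‖d + e‖²`, up to a constant, for all increments `d`, `e` of `w` and `Q` allowed by
cocoercivity. -/
theorem weighted_norm_sq_le {t s : ℝ} (ht : 0 < t) (hs1 : s ≤ 1)
    (hs : 2 * t ^ 2 - t ≤ 2 * (1 - s)) {d e : G} (hde : ‖e‖ ^ 2 ≤ t * ⟪d, e⟫_ℝ) (k : ℕ) :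
    (2 * k + 1) * (s / (1 + t) ^ 2) * ‖d + e‖ ^ 2
      ≤ (2 * k + 1) * ‖d‖ ^ 2 + (k + 1) * (2 * ⟪d, e⟫_ℝ - (1 + t) / t * ‖e‖ ^ 2)
        + k * (1 / t * ‖e‖ ^ 2 - t / (1 + t) * ‖d + e‖ ^ 2) := by
  -- With `d = e / t + h`, cocoercivity reads `0 ≤ ⟪h, e⟫`.
  obtain ⟨h, rfl⟩ : ∃ h, d = (1 / t) • e + h := ⟨d - (1 / t) • e, by abel⟩
  have hm : 0 ≤ ⟪h, e⟫_ℝ := by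
    have : t * ⟪(1 / t) • e + h, e⟫_ℝ = ‖e‖ ^ 2 + t * ⟪h, e⟫_ℝ := by
      rw [inner_add_left, real_inner_smul_left, real_inner_self_eq_norm_sq]; field_simp
    rw [this] at hde
    exact nonneg_of_mul_nonneg_right (by linarith) ht
  have e1 : ‖(1 / t) • e + h‖ ^ 2 = ‖e‖ ^ 2 / t ^ 2 + 2 / t * ⟪h, e⟫_ℝ + ‖h‖ ^ 2 := by
    rw [norm_add_sq_real, real_inner_smul_left, norm_smul, real_inner_comm h, mul_pow,
      Real.norm_eq_abs, sq_abs]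
    field_simp
  have e2 : ⟪(1 / t) • e + h, e⟫_ℝ = ‖e‖ ^ 2 / t + ⟪h, e⟫_ℝ := by
    rw [inner_add_left, real_inner_smul_left, real_inner_self_eq_norm_sq]; ring
  have e3 : ‖(1 / t) • e + h + e‖ ^ 2
      = (1 + t) ^ 2 / t ^ 2 * ‖e‖ ^ 2 + 2 * (1 + t) / t * ⟪h, e⟫_ℝ + ‖h‖ ^ 2 := by
    rw [norm_add_sq_real, e1, e2]; field_simp; ring
  rw [e1, e2, e3]
  have ht1 : 0 < 1 + t := by linarith
  have hk : (0 : ℝ) ≤ k := k.cast_nonneg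
  have hE := sq_nonneg ‖e‖
  have hH := sq_nonneg ‖h‖
  generalize ‖e‖ ^ 2 = E at *
  generalize ‖h‖ ^ 2 = F at *
  generalize ⟪h, e⟫_ℝ = m at *
  -- The difference of both sides is a combination of `E = ‖e‖²`, `m = ⟪h, e⟫` and `F = ‖h‖²`,
  -- affine in `k`; its coefficients are nonnegative both at `k = -1/2` and in the slope.
  have hES : 0 ≤ (t - 2 * t ^ 2 + 2 * (1 - s)) / t ^ 2 * E := by
    apply mul_nonneg (div_nonneg (by linarith) (by positivity)) hE
  have hmS : 0 ≤ 2 / t * (2 - 2 * s / (1 + t)) * m := by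
    refine mul_nonneg (mul_nonneg (by positivity) ?_) hm
    rw [sub_nonneg, div_le_iff₀ ht1]; nlinarith
  have hFS : 0 ≤ (2 - t / (1 + t) - 2 * s / (1 + t) ^ 2) * F := by
    refine mul_nonneg ?_ hH
    have : 2 - t / (1 + t) - 2 * s / (1 + t) ^ 2
      = (2 * (1 + t) ^ 2 - t * (1 + t) - 2 * s) / (1 + t) ^ 2 := by field_simp
    rw [this]
    apply div_nonneg _ (by positivity)
    nlinarith
  have hED : 0 ≤ 1 / (2 * t) * E := by positivity
  have hmD : 0 ≤ 2 * m := by positivity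
  have hFD : 0 ≤ t / (2 * (1 + t)) * F := by positivity
  have key : (2 * k + 1) * (E / t ^ 2 + 2 / t * m + F)
        + (k + 1) * (2 * (E / t + m) - (1 + t) / t * E)
        + k * (1 / t * E - t / (1 + t) * ((1 + t) ^ 2 / t ^ 2 * E + 2 * (1 + t) / t * m + F))
        - (2 * k + 1) * (s / (1 + t) ^ 2)
          * ((1 + t) ^ 2 / t ^ 2 * E + 2 * (1 + t) / t * m + F)
      = (k + 1 / 2) * ((t - 2 * t ^ 2 + 2 * (1 - s)) / t ^ 2 * E
          + 2 / t * (2 - 2 * s / (1 + t)) * m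
          + (2 - t / (1 + t) - 2 * s / (1 + t) ^ 2) * F)
        + (1 / (2 * t) * E + 2 * m + t / (2 * (1 + t)) * F) := by
    field_simp
    ring
  have : 0 ≤ (k + 1 / 2 : ℝ) * ((t - 2 * t ^ 2 + 2 * (1 - s)) / t ^ 2 * E
          + 2 / t * (2 - 2 * s / (1 + t)) * m
          + (2 - t / (1 + t) - 2 * s / (1 + t) ^ 2) * F) :=
    mul_nonneg (by linarith) (by linarith)
  linarith

namespace IsSplittingOrbit

variable {t : ℝ} {w v P Q : ℕ → G} {Φ Ψ : ℕ → ℝ} {ws Qs : G} {Φs Ψs : ℝ}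

theorem cocoercive (h : IsSplittingOrbit t w v P Q Φ Ψ ws Qs Φs Ψs) (ht : 0 < t) (i j : ℕ) :
    ‖Q i - Q j‖ ^ 2 ≤ t * ⟪w i - w j, Q i - Q j⟫_ℝ := by
  have h1 := h.le_Ψ i j
  have h2 := h.le_Ψ j i
  have h3 : ⟪Q j, w i - w j⟫_ℝ + ⟪Q i, w j - w i⟫_ℝ = -⟪w i - w j, Q i - Q j⟫_ℝ := by
    rw [← neg_sub (w i) (w j), inner_neg_right, inner_sub_right (w i - w j),
      real_inner_comm (Q i) (w i - w j), real_inner_comm (Q j) (w i - w j)]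
    ring
  rw [norm_sub_rev (Q j)] at h2
  have h4 : 1 / t * ‖Q i - Q j‖ ^ 2 ≤ ⟪w i - w j, Q i - Q j⟫_ℝ := by
    have : 1 / t * ‖Q i - Q j‖ ^ 2 = 2 * (1 / (2 * t) * ‖Q i - Q j‖ ^ 2) := by ring
    linarith
  calc ‖Q i - Q j‖ ^ 2 = t * (1 / t * ‖Q i - Q j‖ ^ 2) := by field_simp
    _ ≤ _ := mul_le_mul_of_nonneg_left h4 ht.le

/-- The Douglas-Rachford operator is nonexpansive along the orbit. -/
theorem norm_sub_sq_le (h : IsSplittingOrbit t w v P Q Φ Ψ ws Qs Φs Ψs) (ht : 0 < t) (i j : ℕ) :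
    ‖(w i - P i) - (w j - P j)‖ ^ 2 ≤ ‖(w i + Q i) - (w j + Q j)‖ ^ 2 := by
  have h1 := inner_nonneg_of_cocoercive ht (h.cocoercive ht i j)
  have h2 : 0 ≤ ⟪P i - P j, (w i - w j) - (P i - P j) - (Q i - Q j)⟫_ℝ := by
    have a1 := h.le_Φ i j
    have a2 := h.le_Φ j i
    have : (w i - w j) - (P i - P j) - (Q i - Q j) = v i - v j := by
      rw [h.v_eq, h.v_eq]; abel
    rw [this, inner_sub_left]
    rw [← neg_sub (v i), inner_neg_right] at a2
    linarith
  convert norm_sq_sub_le_of_monotone h1 h2 using 3 <;> abel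

theorem norm_sub_star_sq_le (h : IsSplittingOrbit t w v P Q Φ Ψ ws Qs Φs Ψs) (ht : 0 < t)
    (k : ℕ) : ‖(w k - P k) - (ws + Qs)‖ ^ 2 ≤ ‖(w k + Q k) - (ws + Qs)‖ ^ 2 := by
  have h1 : 0 ≤ ⟪w k - ws, Q k - Qs⟫_ℝ := by
    have a1 := h.le_Ψs k
    have a2 := h.Ψs_le k
    have : 0 ≤ 1 / (2 * t) * ‖Q k - Qs‖ ^ 2 := by positivity
    have : 0 ≤ 1 / (2 * t) * ‖Qs - Q k‖ ^ 2 := by positivity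
    rw [← neg_sub (w k), inner_neg_right] at a1
    rw [real_inner_comm, inner_sub_left]
    linarith
  have h2 : 0 ≤ ⟪P k - -Qs, (w k - ws) - (P k - -Qs) - (Q k - Qs)⟫_ℝ := by
    have a1 := h.le_Φs k
    have a2 := h.Φs_le k
    have : (w k - ws) - (P k - -Qs) - (Q k - Qs) = v k - ws := by
      rw [h.v_eq]; abel
    rw [this, inner_sub_left]
    rw [← neg_sub (v k), inner_neg_right] at a1
    linarith
  convert norm_sq_sub_le_of_monotone h1 h2 using 3 <;> abel

theorem w_add_Q_succ (h : IsSplittingOrbit t w v P Q Φ Ψ ws Qs Φs Ψs) (k : ℕ) :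
    w (k + 1) + Q (k + 1) = w k - P k := by
  rw [h.w_succ]; abel

/-- Fejér monotonicity with respect to the fixed point `ws + Qs`. -/
theorem fejer (h : IsSplittingOrbit t w v P Q Φ Ψ ws Qs Φs Ψs) (ht : 0 < t) (k : ℕ) :
    ‖(w k + Q k) - (ws + Qs)‖ ≤ ‖(w 0 + Q 0) - (ws + Qs)‖ := by
  induction k with
  | zero => exact le_rfl
  | succ k ih =>
    refine le_trans ?_ ih
    rw [h.w_add_Q_succ]
    exact le_of_sq_le_sq (h.norm_sub_star_sq_le ht k) (norm_nonneg _)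

/-- The fixed-point residual `‖P k + Q k‖` decreases. -/
theorem norm_add_antitone (h : IsSplittingOrbit t w v P Q Φ Ψ ws Qs Φs Ψs) (ht : 0 < t) :
    Antitone fun k => ‖P k + Q k‖ := by
  refine antitone_nat_of_succ_le fun k => ?_
  have h1 := h.norm_sub_sq_le ht (k + 1) k
  rw [← h.w_add_Q_succ k, ← norm_neg, ← norm_neg (w (k + 1) + Q (k + 1) - _)] at h1
  have h2 := le_of_sq_le_sq h1 (norm_nonneg _)
  have e1 : -(w (k + 1) - P (k + 1) - (w (k + 1) + Q (k + 1))) = P (k + 1) + Q (k + 1) := by abel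
  have e2 : -(w (k + 1) + Q (k + 1) - (w k + Q k)) = P k + Q k := by
    rw [h.w_add_Q_succ]; abel
  rwa [e1, e2] at h2

/-- Moving from `w k` to `w (k + 1) = w k - P k - Q (k + 1)` decreases the squared distance to the
minimizer by the optimality gap at `w (k + 1)`, in which the first function is replaced by its
linearization at `v k`. -/
theorem descent (h : IsSplittingOrbit t w v P Q Φ Ψ ws Qs Φs Ψs) (ht : 0 < t) (k : ℕ) :
    ‖w (k + 1) - ws‖ ^ 2
        + 2 * (Φ k + ⟪P k, w (k + 1) - v k⟫_ℝ + Ψ (k + 1) - Φs - Ψs)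
        + ‖w (k + 1) - w k‖ ^ 2 ≤ ‖w k - ws‖ ^ 2 := by
  have h1 := h.le_Φs k
  have h2 := h.le_Ψs (k + 1)
  have h3 : 0 ≤ 1 / (2 * t) * ‖Qs - Q (k + 1)‖ ^ 2 := by positivity
  have e1 : w k - ws = (w (k + 1) - ws) + (P k + Q (k + 1)) := by rw [h.w_succ]; abel
  have e2 : w (k + 1) - w k = -(P k + Q (k + 1)) := by rw [h.w_succ]; abel
  have e3 : ws - v k = (w (k + 1) - v k) - (w (k + 1) - ws) := by abel
  rw [e3, inner_sub_right] at h1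
  rw [← neg_sub (w (k + 1)), inner_neg_right] at h2
  rw [e1, e2, norm_neg, norm_add_sq_real (w (k + 1) - ws), inner_add_right, real_inner_comm (P k),
    real_inner_comm (Q (k + 1))]
  linarith

/-- The gap of `descent` decreases, up to error terms in the increments, by twice the squared
increment of `w`. -/
theorem gap_succ_le (h : IsSplittingOrbit t w v P Q Φ Ψ ws Qs Φs Ψs) (k : ℕ) :
    2 * (Φ (k + 1) + ⟪P (k + 1), w (k + 2) - v (k + 1)⟫_ℝ + Ψ (k + 2) - Φs - Ψs)
        + 2 * ‖w (k + 2) - w (k + 1)‖ ^ 2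
        + 2 * ⟪w (k + 1) - w k, Q (k + 1) - Q k⟫_ℝ
        - 2 * ⟪(w (k + 2) - w (k + 1)) + (Q (k + 2) - Q (k + 1)), Q (k + 1) - Q k⟫_ℝ
        + 1 / t * ‖Q (k + 2) - Q (k + 1)‖ ^ 2
      ≤ 2 * (Φ k + ⟪P k, w (k + 1) - v k⟫_ℝ + Ψ (k + 1) - Φs - Ψs) := by
  have h1 := h.le_Φ k (k + 1)
  have h2 := h.le_Ψ (k + 1) (k + 2)
  have hd : w (k + 2) - w (k + 1) = -(P (k + 1) + Q (k + 2)) := by rw [h.w_succ (k + 1)]; abel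
  have hv : v k - w (k + 1) = Q (k + 1) - Q k := by rw [h.v_eq, h.w_succ]; abel
  -- The linear terms combine because `P (k + 1) + Q (k + 2)` is minus the increment of `w`.
  have e1 : ⟪P (k + 1), v k - v (k + 1)⟫_ℝ + ⟪Q (k + 2), w (k + 1) - w (k + 2)⟫_ℝ
        + ⟪P k, w (k + 1) - v k⟫_ℝ - ⟪P (k + 1), w (k + 2) - v (k + 1)⟫_ℝ
      = ‖w (k + 2) - w (k + 1)‖ ^ 2 + ⟪P (k + 1) - P k, Q (k + 1) - Q k⟫_ℝ := by
    have a1 : v k - v (k + 1)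
        = (Q (k + 1) - Q k) - (w (k + 2) - w (k + 1)) + (w (k + 2) - v (k + 1)) := by
      rw [← hv]; abel
    rw [a1, ← neg_sub (w (k + 2)), ← neg_sub (v k) (w (k + 1)), hv, hd]
    rw [norm_neg, ← real_inner_self_eq_norm_sq]
    simp only [inner_add_right, inner_sub_right, inner_neg_right, inner_sub_left, inner_add_left]
    ring
  have e2 : P (k + 1) - P k
      = (w (k + 1) - w k) - ((w (k + 2) - w (k + 1)) + (Q (k + 2) - Q (k + 1))) := by
    rw [hd, h.w_succ k]; abel
  rw [e2, inner_sub_left] at e1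
  rw [norm_sub_rev (Q (k + 1))] at h2
  have e3 : 1 / t * ‖Q (k + 2) - Q (k + 1)‖ ^ 2
      = 2 * (1 / (2 * t) * ‖Q (k + 2) - Q (k + 1)‖ ^ 2) := by ring
  rw [e3]
  linarith

/-- The gap of `descent` need not be nonnegative, as it involves a linearization, but it is bounded
below by a quadratic form in the increments. -/
theorem le_gap (h : IsSplittingOrbit t w v P Q Φ Ψ ws Qs Φs Ψs) (ht : 0 < t) (k : ℕ) :
    2 * ⟪w (k + 1) - w k, Q (k + 1) - Q k⟫_ℝ - t * ‖Q (k + 1) - Q k‖ ^ 2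
      ≤ 2 * (Φ k + ⟪P k, w (k + 1) - v k⟫_ℝ + Ψ (k + 1) - Φs - Ψs) := by
  have h1 := h.Φs_le k
  have h2 := h.Ψs_le (k + 1)
  have hd : w (k + 1) - w k = -(P k + Q (k + 1)) := by rw [h.w_succ k]; abel
  have hv : w (k + 1) - v k = -(Q (k + 1) - Q k) := by rw [h.v_eq, h.w_succ]; abel
  have a1 : v k - ws = (w (k + 1) - ws) - (w (k + 1) - v k) := by abel
  have hsq : 0 ≤ 1 / t * ‖t • (Q (k + 1) - Q k) + (Q (k + 1) - Qs)‖ ^ 2 := by positivity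
  rw [a1, hv] at h1
  rw [hv, hd]
  have e : 1 / t * ‖t • (Q (k + 1) - Q k) + (Q (k + 1) - Qs)‖ ^ 2
      = t * ‖Q (k + 1) - Q k‖ ^ 2 + 2 * ⟪Q (k + 1) - Qs, Q (k + 1) - Q k⟫_ℝ
        + 2 * (1 / (2 * t) * ‖Q (k + 1) - Qs‖ ^ 2) := by
    rw [norm_add_sq_real, real_inner_smul_left, norm_smul, mul_pow, Real.norm_eq_abs, sq_abs,
      real_inner_comm (Q (k + 1) - Q k)]
    field_simp
  rw [e] at hsq
  generalize Q (k + 1) - Q k = e at *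
  simp only [inner_add_left, inner_sub_left, inner_neg_left, inner_neg_right,
    inner_sub_right] at *
  linarith

/-- `descent` summed over the first `N + 1` steps, with the gaps summed by parts through
`gap_succ_le`; the cross terms `⟪d (k + 1) + e (k + 1), e k⟫` are split by Young's inequality with
weight `t / (1 + t)`, for which `weighted_norm_sq_le` holds up to the critical step size. -/
theorem weighted_energy_le (h : IsSplittingOrbit t w v P Q Φ Ψ ws Qs Φs Ψs) (ht : 0 < t)
    (N : ℕ) :
    ‖w (N + 1) - ws‖ ^ 2
        + (N + 1) * (2 * (Φ N + ⟪P N, w (N + 1) - v N⟫_ℝ + Ψ (N + 1) - Φs - Ψs))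
        + ∑ k ∈ Finset.range N, ((2 * k + 1) * ‖w (k + 1) - w k‖ ^ 2
          + (k + 1) * (2 * ⟪w (k + 1) - w k, Q (k + 1) - Q k⟫_ℝ
            - (1 + t) / t * ‖Q (k + 1) - Q k‖ ^ 2)
          + k * (1 / t * ‖Q (k + 1) - Q k‖ ^ 2
            - t / (1 + t) * ‖(w (k + 1) - w k) + (Q (k + 1) - Q k)‖ ^ 2))
        + (2 * N + 1) * ‖w (N + 1) - w N‖ ^ 2
        + N * (1 / t * ‖Q (N + 1) - Q N‖ ^ 2
            - t / (1 + t) * ‖(w (N + 1) - w N) + (Q (N + 1) - Q N)‖ ^ 2)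
      ≤ ‖w 0 - ws‖ ^ 2 := by
  induction N with
  | zero => simpa using h.descent ht 0
  | succ N ih =>
    refine le_trans ?_ ih
    have h1 := h.descent ht (N + 1)
    have h2 := h.gap_succ_le N
    have ht1 : 0 < 1 + t := by linarith
    have young : 2 * ⟪(w (N + 2) - w (N + 1)) + (Q (N + 2) - Q (N + 1)), Q (N + 1) - Q N⟫_ℝ
        ≤ t / (1 + t) * ‖(w (N + 2) - w (N + 1)) + (Q (N + 2) - Q (N + 1))‖ ^ 2
          + (1 + t) / t * ‖Q (N + 1) - Q N‖ ^ 2 := by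
      generalize (w (N + 2) - w (N + 1)) + (Q (N + 2) - Q (N + 1)) = z
      generalize Q (N + 1) - Q N = e
      have : 0 ≤ t / (1 + t) * ‖z - ((1 + t) / t) • e‖ ^ 2 := by positivity
      rw [norm_sub_sq_real, real_inner_smul_right, norm_smul, mul_pow, Real.norm_eq_abs,
        sq_abs] at this
      have e : t / (1 + t) * (‖z‖ ^ 2 - 2 * ((1 + t) / t * ⟪z, e⟫_ℝ)
          + ((1 + t) / t) ^ 2 * ‖e‖ ^ 2)
          = t / (1 + t) * ‖z‖ ^ 2 - 2 * ⟪z, e⟫_ℝ + (1 + t) / t * ‖e‖ ^ 2 := by field_simp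
      linarith
    have hN : (0 : ℝ) ≤ N + 1 := by positivity
    have h3 := mul_le_mul_of_nonneg_left h2 hN
    have h4 := mul_le_mul_of_nonneg_left young hN
    rw [Finset.sum_range_succ]
    push_cast
    linarith

/-- The residuals are summable with weights `2 k + 1`. The condition `t ≤ (1 + t) / t` lets
`le_gap` absorb the last, unmatched gap. -/
theorem sum_norm_add_sq_le (h : IsSplittingOrbit t w v P Q Φ Ψ ws Qs Φs Ψs) (ht : 0 < t)
    {s : ℝ} (hs1 : s ≤ 1) (hs : 2 * t ^ 2 - t ≤ 2 * (1 - s))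
    (htt : t ≤ (1 + t) / t) (N : ℕ) :
    ∑ k ∈ Finset.range N, (2 * k + 1) * (s / (1 + t) ^ 2) * ‖P k + Q k‖ ^ 2
      ≤ ‖w 0 - ws‖ ^ 2 := by
  have hterm : ∀ k : ℕ, (2 * k + 1) * (s / (1 + t) ^ 2) * ‖P k + Q k‖ ^ 2
      ≤ (2 * k + 1) * ‖w (k + 1) - w k‖ ^ 2
          + (k + 1) * (2 * ⟪w (k + 1) - w k, Q (k + 1) - Q k⟫_ℝ
            - (1 + t) / t * ‖Q (k + 1) - Q k‖ ^ 2)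
          + k * (1 / t * ‖Q (k + 1) - Q k‖ ^ 2
            - t / (1 + t) * ‖(w (k + 1) - w k) + (Q (k + 1) - Q k)‖ ^ 2) := fun k => by
    have e : P k + Q k = -((w (k + 1) - w k) + (Q (k + 1) - Q k)) := by rw [h.w_succ]; abel
    rw [e, norm_neg]
    exact weighted_norm_sq_le ht hs1 hs (h.cocoercive ht _ _) k
  rcases N with _ | N
  · simp
  have h1 := h.weighted_energy_le ht N
  have h2 := h.le_gap ht N
  have h3 := hterm N
  have h4 := Finset.sum_le_sum fun k (_ : k ∈ Finset.range N) => hterm k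
  have h5 := mul_le_mul_of_nonneg_right htt (sq_nonneg ‖Q (N + 1) - Q N‖)
  have hN : (0 : ℝ) ≤ N + 1 := by positivity
  have h6 := mul_le_mul_of_nonneg_left h2 hN
  have h7 := mul_le_mul_of_nonneg_left h5 hN
  rw [Finset.sum_range_succ]
  have := sq_nonneg ‖w (N + 1) - ws‖
  linarith

end IsSplittingOrbit

end Hilbert

/-! ### Antitone sequences with bounded weighted sums -/

theorem sum_range_two_mul_add_one (n : ℕ) :
    ∑ k ∈ Finset.range n, (2 * (k : ℝ) + 1) = (n : ℝ) ^ 2 := by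
  induction n with
  | zero => simp
  | succ n ih => rw [Finset.sum_range_succ, ih]; push_cast; ring

theorem sq_mul_le_of_antitone {a : ℕ → ℝ} (ha : Antitone a) (n : ℕ) :
    (n : ℝ) ^ 2 * a n ≤ ∑ k ∈ Finset.range n, (2 * k + 1) * a k := by
  rw [← sum_range_two_mul_add_one, Finset.sum_mul]
  exact Finset.sum_le_sum fun k hk => mul_le_mul_of_nonneg_left
    (ha (Finset.mem_range.1 hk).le) (by positivity)

/-- An antitone nonnegative sequence with `∑ (2 k + 1) a k < ∞` is `o(1 / k²)`, because
`(3 / 4) n² a n` is at most the part of the series between `n / 2` and `n`. -/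
theorem isLittleO_of_antitone_of_sum_le {a : ℕ → ℝ} (ha : Antitone a) (ha0 : ∀ k, 0 ≤ a k)
    {C : ℝ} (hC : ∀ n, ∑ k ∈ Finset.range n, (2 * k + 1) * a k ≤ C) :
    a =o[atTop] fun k : ℕ => 1 / (k : ℝ) ^ 2 := by
  set S : ℕ → ℝ := fun n => ∑ k ∈ Finset.range n, (2 * k + 1) * a k with hS
  have hsum : Summable fun k : ℕ => (2 * (k : ℝ) + 1) * a k :=
    summable_of_sum_range_le (fun k => mul_nonneg (by positivity) (ha0 k)) hC
  have hlim := hsum.hasSum.tendsto_sum_nat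
  have hhalf : Tendsto (fun n : ℕ => n / 2) atTop atTop :=
    Nat.tendsto_div_const_atTop two_ne_zero
  have hdiff : Tendsto (fun n => 4 / 3 * (S n - S (n / 2))) atTop (𝓝 0) := by
    simpa using (hlim.sub (hlim.comp hhalf)).const_mul (4 / 3 : ℝ)
  have hbound : ∀ n : ℕ, (n : ℝ) ^ 2 * a n ≤ 4 / 3 * (S n - S (n / 2)) := fun n => by
    have hle : n / 2 ≤ n := Nat.div_le_self n 2
    have h1 : S n - S (n / 2) = ∑ k ∈ Finset.Ico (n / 2) n, (2 * k + 1) * a k :=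
      (Finset.sum_Ico_eq_sub _ hle).symm
    have h2 : ∑ k ∈ Finset.Ico (n / 2) n, (2 * (k : ℝ) + 1)
        = (n : ℝ) ^ 2 - ((n / 2 : ℕ) : ℝ) ^ 2 := by
      rw [Finset.sum_Ico_eq_sub _ hle, sum_range_two_mul_add_one, sum_range_two_mul_add_one]
    have h3 : (∑ k ∈ Finset.Ico (n / 2) n, (2 * (k : ℝ) + 1)) * a n ≤ S n - S (n / 2) := by
      rw [h1, Finset.sum_mul]
      exact Finset.sum_le_sum fun k hk => mul_le_mul_of_nonneg_left
        (ha (Finset.mem_Ico.1 hk).2.le) (by positivity)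
    have h4 : ((n / 2 : ℕ) : ℝ) ≤ n / 2 := Nat.cast_div_le
    have h5 : ((n / 2 : ℕ) : ℝ) ^ 2 ≤ (n / 2 : ℝ) ^ 2 := by gcongr
    have h6 := mul_le_mul_of_nonneg_right h5 (ha0 n)
    rw [h2] at h3
    linarith
  have hzero : Tendsto (fun n : ℕ => a n / (1 / (n : ℝ) ^ 2)) atTop (𝓝 0) :=
    squeeze_zero (fun n => div_nonneg (ha0 n) (by positivity))
      (fun n => by simpa [mul_comm] using hbound n) hdiff
  refine (isLittleO_iff_tendsto' ?_).2 hzero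
  filter_upwards [eventually_gt_atTop 0] with n hn h
  have : (0 : ℝ) < 1 / (n : ℝ) ^ 2 := by positivity
  exact absurd h this.ne'

/-! ### Subgradients, conjugates and proximal points -/

section Convex

variable {H : Type*} [NormedAddCommGroup H] [InnerProductSpace ℝ H]

theorem toReal_segment_le {μ : ℝ} {f : H → EReal} (hf : ConvexModulus μ f) (hbot : ∀ x, f x ≠ ⊥)
    {x y : H} (hx : f x ≠ ⊤) (hy : f y ≠ ⊤) {s : ℝ} (hs0 : 0 ≤ s) (hs1 : s ≤ 1) :
    f (x + s • (y - x)) ≠ ⊤ ∧ (f (x + s • (y - x))).toReal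
      ≤ (1 - s) * (f x).toReal + s * (f y).toReal - μ / 2 * (s * (1 - s)) * ‖y - x‖ ^ 2 := by
  have h := hf y x s (1 - s) hs0 (by linarith) (by ring)
  have e : s • y + (1 - s) • x = x + s • (y - x) := by module
  rw [e] at h
  have hb := hbot (x + s • (y - x))
  generalize f (x + s • (y - x)) = u at *
  have hxb := hbot x
  have hyb := hbot y
  generalize f x = a at *
  generalize f y = c at *
  lift a to ℝ using ⟨hx, hxb⟩
  lift c to ℝ using ⟨hy, hyb⟩
  induction u with
  | bot => exact absurd rfl hb
  | top =>
    rw [EReal.top_add_coe] at h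
    exact absurd (top_le_iff.1 h) (by norm_cast)
  | coe u =>
    refine ⟨EReal.coe_ne_top _, ?_⟩
    norm_cast at h
    simp only [EReal.toReal_coe]
    linarith

theorem le_of_forall_small {a b c : ℝ}
    (h : ∀ s : ℝ, 0 < s → s ≤ 1 → a ≤ b + s * c) : a ≤ b := by
  refine le_of_forall_pos_le_add fun ε hε => ?_
  have hc : 0 < |c| + 1 := by positivity
  have h1 := h (min 1 (ε / (|c| + 1))) (by positivity) (min_le_left _ _)
  have h2 : min 1 (ε / (|c| + 1)) * c ≤ ε :=
    calc min 1 (ε / (|c| + 1)) * c ≤ min 1 (ε / (|c| + 1)) * (|c| + 1) := by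
          gcongr; linarith [le_abs_self c]
      _ ≤ ε / (|c| + 1) * (|c| + 1) := by gcongr; exact min_le_right _ _
      _ = ε := by field_simp
  linarith

theorem toReal_add_inner_le {f : H → EReal} {x u : H} (hu : u ∈ subdifferential f x) {y : H}
    (hy : f y ≠ ⊤) : (f x).toReal + ⟪u, y - x⟫_ℝ ≤ (f y).toReal := by
  obtain ⟨h1, h2, h3⟩ := hu
  have h := h3 y
  generalize f x = a at *
  generalize f y = c at *
  lift a to ℝ using ⟨h1, h2⟩
  induction c with
  | bot => exact absurd h (by norm_cast)
  | top => exact absurd rfl hy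
  | coe c => norm_cast at h

/-- The subgradient inequality of a strongly convex function: apply the plain inequality on the
segment from `x` to `y`, divide by the parameter, and let it tend to zero. -/
theorem toReal_add_inner_add_sq_le {μ : ℝ} {f : H → EReal} (hf : ConvexModulus μ f)
    (hbot : ∀ x, f x ≠ ⊥) {x u : H} (hu : u ∈ subdifferential f x) {y : H} (hy : f y ≠ ⊤) :
    (f x).toReal + ⟪u, y - x⟫_ℝ + μ / 2 * ‖y - x‖ ^ 2 ≤ (f y).toReal := by
  refine le_of_forall_small (c := μ / 2 * ‖y - x‖ ^ 2) fun s hs0 hs1 => ?_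
  obtain ⟨hfin, hle⟩ := toReal_segment_le hf hbot hu.1 hy hs0.le hs1
  have h := toReal_add_inner_le hu hfin
  rw [add_sub_cancel_left, real_inner_smul_right] at h
  refine le_of_mul_le_mul_left ?_ hs0
  linarith

variable {G : Type*} [NormedAddCommGroup G] [InnerProductSpace ℝ G]

/-- Fermat's rule for an augmented Lagrangian subproblem. No sum rule is needed, since the
quadratic term can be expanded exactly along segments. -/
theorem mem_subdifferential_of_isMinOn [CompleteSpace H] [CompleteSpace G] {f : H → EReal}
    (hf : ClosedProperConvex f) {x : H}
    (A : H →L[ℝ] G) (c w : G) (γ : ℝ)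
    (hmin : IsMinOn (fun x => f x + ((-⟪w, A x + c⟫_ℝ + γ / 2 * ‖A x + c‖ ^ 2 : ℝ) : EReal))
      Set.univ x) :
    ContinuousLinearMap.adjoint A (w - γ • (A x + c)) ∈ subdifferential f x := by
  have hmin' : ∀ y, f x + ((-⟪w, A x + c⟫_ℝ + γ / 2 * ‖A x + c‖ ^ 2 : ℝ) : EReal)
      ≤ f y + ((-⟪w, A y + c⟫_ℝ + γ / 2 * ‖A y + c‖ ^ 2 : ℝ) : EReal) :=
    fun y => isMinOn_iff.1 hmin y (Set.mem_univ y)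
  have hx : f x ≠ ⊤ := by
    intro htop
    obtain ⟨y, hy⟩ := hf.proper
    have h := hmin' y
    rw [htop, EReal.top_add_coe, top_le_iff] at h
    have hyb := hf.ne_bot y
    lift f y to ℝ using ⟨hy, hyb⟩ with r
    exact EReal.coe_ne_top _ (by exact_mod_cast h)
  have hreal : ∀ y, f y ≠ ⊤ → (f x).toReal + (-⟪w, A x + c⟫_ℝ + γ / 2 * ‖A x + c‖ ^ 2)
      ≤ (f y).toReal + (-⟪w, A y + c⟫_ℝ + γ / 2 * ‖A y + c‖ ^ 2) := by
    intro y hy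
    have h := hmin' y
    have hyb := hf.ne_bot y
    have hxb := hf.ne_bot x
    rw [← EReal.coe_toReal hx hxb, ← EReal.coe_toReal hy hyb] at h
    exact_mod_cast h
  refine ⟨hx, hf.ne_bot x, fun y => ?_⟩
  by_cases hy : f y = ⊤
  · rw [hy]; exact le_top
  rw [← EReal.coe_toReal hx (hf.ne_bot x), ← EReal.coe_toReal hy (hf.ne_bot y)]
  norm_cast
  rw [ContinuousLinearMap.adjoint_inner_left]
  refine le_of_forall_small (c := γ / 2 * ‖A (y - x)‖ ^ 2) fun s hs0 hs1 => ?_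
  obtain ⟨hfin, hle⟩ := toReal_segment_le hf.convex hf.ne_bot hx hy hs0.le hs1
  have h := hreal _ hfin
  have e : A (x + s • (y - x)) + c = (A x + c) + s • A (y - x) := by
    rw [map_add, map_smul]; abel
  rw [e, norm_add_sq_real (A x + c), inner_add_right w (A x + c), real_inner_smul_right,
    real_inner_smul_right,
    norm_smul, mul_pow, Real.norm_eq_abs, sq_abs] at h
  rw [inner_sub_left, real_inner_smul_left]
  refine le_of_mul_le_mul_left ?_ hs0
  linarith

/-- The resolvent description of the proximal point. It also covers the existence of the minimizer,
so that the choice in the definition of `prox` is never made on an empty set. -/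
theorem prox_eq_of_mem_subdifferential {γ : ℝ} (hγ : 0 < γ) {h : H → EReal} {z p : H}
    (hp : (1 / γ) • (z - p) ∈ subdifferential h p) : prox γ h z = p := by
  -- The proximal objective grows quadratically away from `p`.
  have key : ∀ q, h p + ((1 / (2 * γ) * ‖p - z‖ ^ 2 + 1 / (2 * γ) * ‖q - p‖ ^ 2 : ℝ) : EReal)
      ≤ h q + ((1 / (2 * γ) * ‖q - z‖ ^ 2 : ℝ) : EReal) := by
    intro q
    have h1 := hp.2.2 q
    have e : 1 / (2 * γ) * ‖q - z‖ ^ 2 = ⟪(1 / γ) • (z - p), q - p⟫_ℝ * (-1)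
        + (1 / (2 * γ) * ‖p - z‖ ^ 2 + 1 / (2 * γ) * ‖q - p‖ ^ 2) := by
      have : q - z = (q - p) - (z - p) := by abel
      rw [this, norm_sub_sq_real, real_inner_smul_left, norm_sub_rev p z,
        real_inner_comm (q - p)]
      field_simp
      ring
    have hpt := hp.1
    have hpb := hp.2.1
    generalize h q = c at *
    lift h p to ℝ using ⟨hpt, hpb⟩ with a
    induction c with
    | bot => exact absurd h1 (by norm_cast)
    | top => rw [EReal.top_add_coe]; exact le_top
    | coe c =>
      norm_cast at h1 ⊢
      linarith
  have hmin : IsMinOn (fun q => h q + ((1 / (2 * γ) * ‖q - z‖ ^ 2 : ℝ) : EReal)) Set.univ p := by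
    refine isMinOn_iff.2 fun q _ => le_trans ?_ (key q)
    gcongr
    exact_mod_cast le_add_of_nonneg_right (by positivity)
  have hspec : IsMinOn (fun q => h q + ((1 / (2 * γ) * ‖q - z‖ ^ 2 : ℝ) : EReal)) Set.univ
      (prox γ h z) := Classical.epsilon_spec (p := fun p => IsMinOn
        (fun q => h q + ((1 / (2 * γ) * ‖q - z‖ ^ 2 : ℝ) : EReal)) Set.univ p) ⟨p, hmin⟩
  have h1 := (key _).trans (isMinOn_iff.1 hspec p (Set.mem_univ p))
  have hpt := hp.1
  have hpb := hp.2.1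
  lift h p to ℝ using ⟨hpt, hpb⟩ with a
  norm_cast at h1
  have h2 : 1 / (2 * γ) * ‖prox γ h z - p‖ ^ 2 ≤ 0 := by linarith
  have h3 : ‖prox γ h z - p‖ ^ 2 ≤ 0 := nonpos_of_mul_nonpos_right h2 (by positivity)
  have h4 : ‖prox γ h z - p‖ = 0 := by
    exact pow_eq_zero_iff two_ne_zero |>.1 (le_antisymm h3 (sq_nonneg _))
  exact sub_eq_zero.1 (norm_eq_zero.1 h4)

/-- Equality in the Fenchel-Young inequality. -/
theorem conjugate_eq_of_mem_subdifferential {f : H → EReal} {x u : H}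
    (hu : u ∈ subdifferential f x) : conjugate f u = ((⟪u, x⟫_ℝ - (f x).toReal : ℝ) : EReal) := by
  obtain ⟨h1, h2, h3⟩ := hu
  apply le_antisymm
  · refine iSup_le fun y => ?_
    have h := h3 y
    generalize f y = c at *
    lift f x to ℝ using ⟨h1, h2⟩ with a
    induction c with
    | bot => exact absurd h (by norm_cast)
    | top => simp
    | coe c =>
      rw [inner_sub_right] at h
      norm_cast at h ⊢
      rw [EReal.toReal_coe]
      linarith
  · refine le_trans ?_ (le_iSup _ x)
    lift f x to ℝ using ⟨h1, h2⟩ with a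
    norm_cast

theorem mem_subdifferential_dualG [CompleteSpace H] [CompleteSpace G] {g : H → EReal}
    {B : H →L[ℝ] G} (b : G) {y : H} {w : G}
    (hw : ContinuousLinearMap.adjoint B w ∈ subdifferential g y) :
    B y - b ∈ subdifferential (dualG g B b) w := by
  have e : dualG g B b w = ((⟪w, B y⟫_ℝ - (g y).toReal - ⟪w, b⟫_ℝ : ℝ) : EReal) := by
    rw [dualG, conjugate_eq_of_mem_subdifferential hw, ContinuousLinearMap.adjoint_inner_left]
    norm_cast
  refine ⟨by rw [e]; exact EReal.coe_ne_top _, by rw [e]; exact EReal.coe_ne_bot _, fun w' => ?_⟩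
  have h : ((⟪w', B y⟫_ℝ - (g y).toReal : ℝ) : EReal)
      ≤ conjugate g (ContinuousLinearMap.adjoint B w') := by
    refine le_trans ?_ (le_iSup _ y)
    rw [ContinuousLinearMap.adjoint_inner_left]
    conv_rhs => rw [← EReal.coe_toReal hw.1 hw.2.1]
    norm_cast
  rw [e, dualG]
  refine le_trans ?_ (EReal.sub_le_sub h le_rfl)
  norm_cast
  rw [inner_sub_left, inner_sub_right, inner_sub_right, real_inner_comm w', real_inner_comm w,
    real_inner_comm w', real_inner_comm w]
  linarith

end Convex

/-! ### ADMM as a splitting orbit for the dual problem -/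

section Admm

variable {H₁ H₂ G : Type*}
  [NormedAddCommGroup H₁] [InnerProductSpace ℝ H₁] [CompleteSpace H₁]
  [NormedAddCommGroup H₂] [InnerProductSpace ℝ H₂] [CompleteSpace H₂]
  [NormedAddCommGroup G] [InnerProductSpace ℝ G] [CompleteSpace G]

/-- The subgradient inequality for `f* ∘ A*` at a point where `A x'` is a subgradient, scaled by
`γ`. The values of `f* ∘ A*` are written through the Fenchel-Young equality, and strong convexity of `f`
gives the quadratic term. -/
theorem dual_value_add_inner_le {μ : ℝ} {f : H₁ → EReal} (hf : ConvexModulus μ f)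
    (hbot : ∀ x, f x ≠ ⊥) (A : H₁ →L[ℝ] G) {γ : ℝ} (hγ : 0 < γ) {x x' : H₁} {v : G} (v' : G)
    (hx : ContinuousLinearMap.adjoint A v ∈ subdifferential f x) (hx' : f x' ≠ ⊤) :
    γ * (⟪v', A x'⟫_ℝ - (f x').toReal) + ⟪γ • A x', v - v'⟫_ℝ + γ * (μ / 2 * ‖x' - x‖ ^ 2)
      ≤ γ * (⟪v, A x⟫_ℝ - (f x).toReal) := by
  have h := mul_le_mul_of_nonneg_left (toReal_add_inner_add_sq_le hf hbot hx hx') hγ.le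
  rw [ContinuousLinearMap.adjoint_inner_left, map_sub, inner_sub_right] at h
  rw [real_inner_smul_left, inner_sub_right, real_inner_comm v, real_inner_comm v']
  linarith

/-- Strong convexity of `g` makes the gradient `B y - b` of its dual function Lipschitz with
constant `‖B‖² / μ`; this is the corresponding smooth convex inequality, scaled by `γ`. -/
theorem dual_value_add_inner_add_sq_le {μ : ℝ} (hμ : 0 < μ) {g : H₂ → EReal}
    (hg : ConvexModulus μ g) (hbot : ∀ y, g y ≠ ⊥) {B : H₂ →L[ℝ] G} (hB : B ≠ 0) (b : G)
    {γ : ℝ} (hγ : 0 < γ) {y y' : H₂} {w : G} (w' : G)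
    (hy : ContinuousLinearMap.adjoint B w ∈ subdifferential g y) (hy' : g y' ≠ ⊤) :
    γ * (⟪w', B y' - b⟫_ℝ - (g y').toReal) + ⟪γ • (B y' - b), w - w'⟫_ℝ
        + 1 / (2 * (γ / (μ / ‖B‖ ^ 2))) * ‖γ • (B y - b) - γ • (B y' - b)‖ ^ 2
      ≤ γ * (⟪w, B y - b⟫_ℝ - (g y).toReal) := by
  have h := dual_value_add_inner_le hg hbot B hγ w' hy hy'
  have hB' : 0 < ‖B‖ := norm_pos_iff.2 hB
  have e : γ • (B y - b) - γ • (B y' - b) = -(γ • B (y' - y)) := by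
    rw [map_sub]; module
  have hn : ‖B (y' - y)‖ ^ 2 ≤ ‖B‖ ^ 2 * ‖y' - y‖ ^ 2 := by
    rw [← mul_pow]; exact pow_le_pow_left₀ (norm_nonneg _) (B.le_opNorm _) 2
  have hq : 1 / (2 * (γ / (μ / ‖B‖ ^ 2))) * ‖γ • (B y - b) - γ • (B y' - b)‖ ^ 2
      ≤ γ * (μ / 2 * ‖y' - y‖ ^ 2) := by
    rw [e, norm_neg, norm_smul, mul_pow, Real.norm_eq_abs, sq_abs]
    calc 1 / (2 * (γ / (μ / ‖B‖ ^ 2))) * (γ ^ 2 * ‖B (y' - y)‖ ^ 2)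
        ≤ 1 / (2 * (γ / (μ / ‖B‖ ^ 2))) * (γ ^ 2 * (‖B‖ ^ 2 * ‖y' - y‖ ^ 2)) := by gcongr
      _ = γ * (μ / 2 * ‖y' - y‖ ^ 2) := by field_simp
  rw [real_inner_smul_left] at h ⊢
  simp only [inner_sub_right, inner_sub_left, real_inner_comm w b, real_inner_comm w' b] at h ⊢
  rw [real_inner_comm b w, real_inner_comm b w']
  linarith

end Admm

section Orbit

variable {H₁ H₂ G : Type*}
  [NormedAddCommGroup H₁] [InnerProductSpace ℝ H₁]
  [NormedAddCommGroup H₂] [InnerProductSpace ℝ H₂]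
  [NormedAddCommGroup G] [InnerProductSpace ℝ G]
  {f : H₁ → EReal} {g : H₂ → EReal} {A : H₁ →L[ℝ] G} {B : H₂ →L[ℝ] G} {b : G} {γ : ℝ}
  {z₀ : G} {x : ℕ → H₁} {y : ℕ → H₂} {w : ℕ → G}

theorem IsYUpdate.mem_subdifferential [CompleteSpace H₂] [CompleteSpace G]
    (hg : ClosedProperConvex g) {x : H₁} {y y' : H₂} {w : G}
    (h : IsYUpdate g A B b γ (1 / 2) x y w y') :
    ContinuousLinearMap.adjoint B (w - γ • (A x + B y' - b)) ∈ subdifferential g y' := by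
  have e : ∀ u, A x + B u - b = B u + (A x - b) := fun u => by abel
  have h0 : (2 * (1 / 2) - 1 : ℝ) = 0 := by norm_num
  simp only [IsYUpdate, h0, zero_smul, add_zero, e] at h
  rw [e]
  exact mem_subdifferential_of_isMinOn hg B _ _ γ h

namespace IsRelaxedADMM

theorem w_succ_eq (h : IsRelaxedADMM f g A B b γ (fun _ => 1 / 2) z₀ x y w) (k : ℕ) :
    w (k + 1) = w k - γ • (A (x k) + B (y (k + 1)) - b) := by
  have := h.w_succ k
  simpa [IsWUpdate] using this

theorem w_zero_eq (h : IsRelaxedADMM f g A B b γ (fun _ => 1 / 2) z₀ x y w) :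
    w 0 = z₀ - γ • (B (y 0) - b) := by
  have := h.w_zero
  simpa [IsWUpdate] using this

theorem mem_subdifferential_x [CompleteSpace H₁] [CompleteSpace G]
    (h : IsRelaxedADMM f g A B b γ (fun _ => 1 / 2) z₀ x y w)
    (hf : ClosedProperConvex f) (k : ℕ) :
    ContinuousLinearMap.adjoint A (w k - γ • (A (x k) + B (y k) - b))
      ∈ subdifferential f (x k) := by
  have h1 := h.x_step k
  simp only [IsXUpdate, add_sub_assoc] at h1
  rw [add_sub_assoc]
  exact mem_subdifferential_of_isMinOn hf A _ _ γ h1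

theorem mem_subdifferential_y [CompleteSpace H₂] [CompleteSpace G]
    (h : IsRelaxedADMM f g A B b γ (fun _ => 1 / 2) z₀ x y w)
    (hg : ClosedProperConvex g) (k : ℕ) :
    ContinuousLinearMap.adjoint B (w k) ∈ subdifferential g (y k) := by
  cases k with
  | zero =>
    have h1 := IsYUpdate.mem_subdifferential hg h.y_zero
    rwa [map_zero, zero_add, ← h.w_zero_eq] at h1
  | succ k =>
    rw [h.w_succ_eq]
    exact IsYUpdate.mem_subdifferential hg (h.y_succ k)

theorem w_zero_eq_prox [CompleteSpace H₂] [CompleteSpace G]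
    (h : IsRelaxedADMM f g A B b γ (fun _ => 1 / 2) z₀ x y w)
    (hg : ClosedProperConvex g) (hγ : 0 < γ) : prox γ (dualG g B b) z₀ = w 0 := by
  apply prox_eq_of_mem_subdifferential hγ
  have e : (1 / γ) • (z₀ - w 0) = B (y 0) - b := by
    rw [h.w_zero_eq, sub_sub_cancel, smul_smul, one_div_mul_cancel hγ.ne', one_smul]
  rw [e]
  exact mem_subdifferential_dualG b (h.mem_subdifferential_y hg 0)

end IsRelaxedADMM

variable [CompleteSpace H₁] [CompleteSpace H₂] [CompleteSpace G]

theorem IsOptimalTuple.smul_eq {zs ws : G} {xs : H₁} {ys : H₂}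
    (h : IsOptimalTuple f g A B b γ zs ws xs ys) (hγ : 0 < γ) :
    γ • (B ys - b) = zs - ws := by
  rw [h.dual_subgrad_g, smul_smul, mul_one_div_cancel hγ.ne', one_smul]

theorem IsOptimalTuple.feasible {zs ws : G} {xs : H₁} {ys : H₂}
    (h : IsOptimalTuple f g A B b γ zs ws xs ys) : A xs = -(B ys - b) := by
  rw [h.dual_subgrad_f, h.dual_subgrad_g, refl, ← h.ws_eq]
  module

/-- The dual points `w k` and `w k - γ (A (x k) + B (y k) - b)` of ADMM form a splitting orbit for
`γ d_f` and `γ d_g`, with parameter `t = γ / β`. -/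
theorem IsRelaxedADMM.isSplittingOrbit
    (h : IsRelaxedADMM f g A B b γ (fun _ => 1 / 2) z₀ x y w)
    (hf : ClosedProperConvex f) (hg : ClosedProperConvex g) (hB : B ≠ 0)
    {μ : ℝ} (hμ : 0 < μ) (hgμ : ConvexModulus μ g) (hγ : 0 < γ)
    {zs ws : G} {xs : H₁} {ys : H₂} (hopt : IsOptimalTuple f g A B b γ zs ws xs ys) :
    IsSplittingOrbit (γ / (μ / ‖B‖ ^ 2)) w
      (fun k => w k - γ • (A (x k) + B (y k) - b))
      (fun k => γ • A (x k)) (fun k => γ • (B (y k) - b))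
      (fun k => γ * (⟪w k - γ • (A (x k) + B (y k) - b), A (x k)⟫_ℝ - (f (x k)).toReal))
      (fun k => γ * (⟪w k, B (y k) - b⟫_ℝ - (g (y k)).toReal))
      ws (γ • (B ys - b))
      (γ * (⟪ws, A xs⟫_ℝ - (f xs).toReal)) (γ * (⟪ws, B ys - b⟫_ℝ - (g ys).toReal)) := by
  have hx := h.mem_subdifferential_x hf
  have hy := h.mem_subdifferential_y hg
  have hA : ∀ {u u' : H₁} {v v' : G},
      ContinuousLinearMap.adjoint A v ∈ subdifferential f u → f u' ≠ ⊤ →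
      γ * (⟪v', A u'⟫_ℝ - (f u').toReal) + ⟪γ • A u', v - v'⟫_ℝ
        ≤ γ * (⟪v, A u⟫_ℝ - (f u).toReal) := fun {u u' v v'} hu hu' => by
    simpa using dual_value_add_inner_le hf.convex hf.ne_bot A hγ v' hu hu'
  have hneg : -(γ • (B ys - b)) = γ • A xs := by rw [hopt.feasible, smul_neg]
  refine ⟨fun k => ?_, fun k => ?_, fun i j => hA (hx i) (hx j).1,
    fun k => hA hopt.subgrad_f (hx k).1, fun k => ?_, fun i j => ?_, fun k => ?_, fun k => ?_⟩
  · module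
  · rw [h.w_succ_eq]; module
  · rw [hneg]; exact hA (hx k) hopt.subgrad_f.1
  · exact dual_value_add_inner_add_sq_le hμ hgμ hg.ne_bot hB b hγ _ (hy i) (hy j).1
  · exact dual_value_add_inner_add_sq_le hμ hgμ hg.ne_bot hB b hγ _ hopt.subgrad_g (hy k).1
  · exact dual_value_add_inner_add_sq_le hμ hgμ hg.ne_bot hB b hγ _ (hy k) hopt.subgrad_g.1

/-! ### Objective error and rates -/

theorem neg_mul_norm_le_objectiveError {ws : G} {xs x : H₁} {ys y : H₂}
    (hxs : ContinuousLinearMap.adjoint A ws ∈ subdifferential f xs)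
    (hys : ContinuousLinearMap.adjoint B ws ∈ subdifferential g ys)
    (hfeas : A xs = -(B ys - b)) (hx : f x ≠ ⊤) (hy : g y ≠ ⊤) :
    -(‖ws‖ * ‖A x + B y - b‖) ≤ objectiveError f g x xs y ys := by
  have h1 := toReal_add_inner_le hxs hx
  have h2 := toReal_add_inner_le hys hy
  rw [ContinuousLinearMap.adjoint_inner_left, map_sub] at h1 h2
  have e : ⟪ws, A x + B y - b⟫_ℝ = ⟪ws, A x - A xs⟫_ℝ + ⟪ws, B y - B ys⟫_ℝ := by
    rw [← inner_add_right, hfeas]; congr 1; abel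
  have h3 := neg_le_of_abs_le (abs_real_inner_le_norm ws (A x + B y - b))
  rw [objectiveError]
  linarith

/-- The subgradient inequalities at `x` and `y` bound the error by the inner product of the residual
with `z' - zs + ws`, where `z' = w - γ A x` is the next Douglas-Rachford variable. -/
theorem objectiveError_le {zs ws w : G} {xs x : H₁} {ys y : H₂}
    (hx : ContinuousLinearMap.adjoint A (w - γ • (A x + B y - b)) ∈ subdifferential f x)
    (hy : ContinuousLinearMap.adjoint B w ∈ subdifferential g y)
    (hfeas : A xs = -(B ys - b)) (hzs : γ • (B ys - b) = zs - ws)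
    (hxs : f xs ≠ ⊤) (hys : g ys ≠ ⊤) :
    objectiveError f g x xs y ys
      ≤ ‖A x + B y - b‖ * (‖(w - γ • A x) - zs‖ + ‖ws‖) := by
  have h1 := toReal_add_inner_le hx hxs
  have h2 := toReal_add_inner_le hy hys
  rw [ContinuousLinearMap.adjoint_inner_left, map_sub] at h1 h2
  have e : ⟪A x + B y - b, ((w - γ • A x) - zs) + ws⟫_ℝ
      = -⟪w - γ • (A x + B y - b), A xs - A x⟫_ℝ - ⟪w, B ys - B y⟫_ℝ := by
    have e1 : (w - γ • A x) - zs + ws = w - γ • (A x + (B ys - b)) := by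
      rw [smul_add, hzs]; abel
    have e2 : B ys - B y = -(A x + B y - b) + (A x + (B ys - b)) := by abel
    have e3 : A xs - A x = -(A x + (B ys - b)) := by rw [hfeas]; abel
    rw [e1, e2, e3]
    generalize A x + B y - b = r
    generalize A x + (B ys - b) = c
    simp only [inner_sub_left, inner_sub_right, inner_add_right, inner_neg_right,
      real_inner_smul_left, real_inner_smul_right, real_inner_comm r]
    ring
  have h3 := (real_inner_le_norm (A x + B y - b) (((w - γ • A x) - zs) + ws)).trans
    (mul_le_mul_of_nonneg_left (norm_add_le _ _) (norm_nonneg _))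
  rw [objectiveError]
  linarith

end Orbit

end DualSplitting

theorem mainTheorem11
    {H₁ H₂ G : Type*}
    [NormedAddCommGroup H₁] [InnerProductSpace ℝ H₁] [CompleteSpace H₁]
    [NormedAddCommGroup H₂] [InnerProductSpace ℝ H₂] [CompleteSpace H₂]
    [NormedAddCommGroup G] [InnerProductSpace ℝ G] [CompleteSpace G]
    (f : H₁ → EReal) (g : H₂ → EReal)
    (hf : DualSplitting.ClosedProperConvex f) (hg : DualSplitting.ClosedProperConvex g)
    (A : H₁ →L[ℝ] G) (B : H₂ →L[ℝ] G) (hB : B ≠ 0) (b : G)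
    (μ : ℝ) (hμ : 0 < μ) (hgμ : DualSplitting.ConvexModulus μ g)
    (κ : ℝ) (hκ0 : 0 < κ) (hκ : κ ^ 3 + κ ^ 2 - 2 * κ - 1 = 0)
    (β : ℝ) (hβ : β = μ / ‖B‖ ^ 2)
    (γ : ℝ) (hγ0 : 0 < γ) (hγ : γ < κ * β)
    (z₀ : G) (x : ℕ → H₁) (y : ℕ → H₂) (w : ℕ → G)
    (hadmm : DualSplitting.IsRelaxedADMM f g A B b γ (fun _ => 1 / 2) z₀ x y w)
    (zs ws : G) (xs : H₁) (ys : H₂)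
    (hopt : DualSplitting.IsOptimalTuple f g A B b γ zs ws xs ys)
    (w₀ : G) (hw₀ : w₀ = DualSplitting.prox γ (DualSplitting.dualG g B b) z₀) :
    (∀ k : ℕ, 1 ≤ k →
      ‖A (x k) + B (y k) - b‖ ^ 2
        ≤ β ^ 2 * (1 + γ / β) ^ 2 * ‖w₀ - ws‖ ^ 2
          / (γ ^ 2 * (k : ℝ) ^ 2 * (β ^ 2 - γ ^ 2 / κ ^ 2))) ∧
    ((fun k : ℕ => ‖A (x k) + B (y k) - b‖ ^ 2) =o[atTop] fun k : ℕ => 1 / (k : ℝ) ^ 2) ∧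
    (∀ k : ℕ, f (x k) ≠ ⊤ ∧ g (y k) ≠ ⊤) ∧
    (∀ k : ℕ, 1 ≤ k →
      -(β * (1 + γ / β) * ‖ws‖ * ‖w₀ - ws‖)
          / (γ * (k : ℝ) * √(β ^ 2 - γ ^ 2 / κ ^ 2))
        ≤ DualSplitting.objectiveError f g (x k) xs (y k) ys ∧
      DualSplitting.objectiveError f g (x k) xs (y k) ys
        ≤ β * (1 + γ / β) * ‖w₀ - ws‖ * (‖z₀ - zs‖ + ‖ws‖)
          / (γ * (k : ℝ) * √(β ^ 2 - γ ^ 2 / κ ^ 2))) ∧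
    ((fun k : ℕ => |DualSplitting.objectiveError f g (x k) xs (y k) ys|)
      =o[atTop] fun k : ℕ => 1 / (k : ℝ)) := by
  have hβ0 : 0 < β := by
    have : 0 < ‖B‖ := norm_pos_iff.2 hB
    rw [hβ]; positivity
  have horb := hadmm.isSplittingOrbit hf hg hB hμ hgμ hγ0 hopt
  rw [← hβ] at horb
  have hx := hadmm.mem_subdifferential_x hf
  have hy := hadmm.mem_subdifferential_y hg
  have hzs := hopt.smul_eq hγ0
  have hfeas := hopt.feasible
  rw [hw₀, hadmm.w_zero_eq_prox hg hγ0]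
  have ht0 : 0 < γ / β := by positivity
  have htκ : γ / β < κ := (div_lt_iff₀ hβ0).2 hγ
  have hD : β ^ 2 - γ ^ 2 / κ ^ 2 = β ^ 2 * (1 - (γ / β) ^ 2 / κ ^ 2) := by field_simp
  have hPQ : ∀ k, γ • A (x k) + γ • (B (y k) - b) = γ • (A (x k) + B (y k) - b) := fun k => by
    module
  set t := γ / β with ht
  -- The root `κ ≈ 1.247` lies below `(1 + √17) / 4`, so that `2 κ² - κ - 2 ≤ 0`, which is what
  -- the energy estimate needs.
  have hκ1 : κ < 1.28 := by
    by_contra! hc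
    nlinarith [mul_nonneg hκ0.le (sub_nonneg.2 hc), mul_nonneg (sq_nonneg κ) (sub_nonneg.2 hc)]
  have hs0 : 0 < 1 - t ^ 2 / κ ^ 2 := by
    rw [sub_pos, div_lt_one (by positivity)]
    exact pow_lt_pow_left₀ htκ ht0.le two_ne_zero
  have hs1 : 1 - t ^ 2 / κ ^ 2 ≤ 1 := by
    have : 0 ≤ t ^ 2 / κ ^ 2 := by positivity
    linarith
  have hs2 : 2 * t ^ 2 - t ≤ 2 * (1 - (1 - t ^ 2 / κ ^ 2)) := by
    have h1 : 2 * κ ^ 2 - 2 ≤ κ := by nlinarith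
    have h2 : t * (2 * κ ^ 2 - 2) ≤ κ ^ 2 := by nlinarith
    rw [sub_sub_cancel, ← mul_div_assoc, le_div_iff₀ (by positivity)]
    nlinarith
  have htt : t ≤ (1 + t) / t := by
    rw [le_div_iff₀ ht0]; nlinarith
  set s := 1 - t ^ 2 / κ ^ 2 with hs
  have hsum := horb.sum_norm_add_sq_le ht0 hs1 hs2 htt
  have hanti := horb.norm_add_antitone ht0
  have hfejer := horb.fejer ht0
  simp only [hPQ] at hsum hanti
  set r : ℕ → G := fun k => A (x k) + B (y k) - b with hr
  have hantisq : Antitone fun k => ‖γ • r k‖ ^ 2 := fun i j hij =>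
    pow_le_pow_left₀ (norm_nonneg _) (hanti hij) 2
  have hσ : 0 < s / (1 + t) ^ 2 := by positivity
  have hsum' : ∀ n, ∑ k ∈ Finset.range n, (2 * (k : ℝ) + 1) * ‖γ • r k‖ ^ 2
      ≤ ‖w 0 - ws‖ ^ 2 / (s / (1 + t) ^ 2) := fun n => by
    rw [le_div_iff₀ hσ, Finset.sum_mul]
    refine le_trans (le_of_eq (Finset.sum_congr rfl fun k _ => ?_)) (hsum n)
    ring
  have hnorm : ∀ k, ‖γ • r k‖ ^ 2 = γ ^ 2 * ‖r k‖ ^ 2 := fun k => by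
    rw [norm_smul, mul_pow, Real.norm_eq_abs, sq_abs]
  have hrate : ∀ k : ℕ, 1 ≤ k → ‖r k‖ ^ 2
      ≤ β ^ 2 * (1 + t) ^ 2 * ‖w 0 - ws‖ ^ 2
        / (γ ^ 2 * (k : ℝ) ^ 2 * (β ^ 2 - γ ^ 2 / κ ^ 2)) := by
    intro k hk
    have hk0 : (0 : ℝ) < k := by exact_mod_cast hk
    have h1 := (DualSplitting.sq_mul_le_of_antitone hantisq k).trans (hsum' k)
    simp only [hnorm] at h1
    rw [le_div_iff₀ hσ] at h1
    rw [hD]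
    calc ‖r k‖ ^ 2 = β ^ 2 * (1 + t) ^ 2 / (γ ^ 2 * (k : ℝ) ^ 2 * (β ^ 2 * s))
          * ((k : ℝ) ^ 2 * (γ ^ 2 * ‖r k‖ ^ 2) * (s / (1 + t) ^ 2)) := by field_simp
      _ ≤ β ^ 2 * (1 + t) ^ 2 / (γ ^ 2 * (k : ℝ) ^ 2 * (β ^ 2 * s)) * ‖w 0 - ws‖ ^ 2 :=
        mul_le_mul_of_nonneg_left h1 (by positivity)
      _ = _ := by ring
  have hlittle : (fun k : ℕ => ‖r k‖ ^ 2) =o[atTop] fun k : ℕ => 1 / (k : ℝ) ^ 2 := by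
    have h1 := DualSplitting.isLittleO_of_antitone_of_sum_le hantisq (fun k => sq_nonneg _)
      hsum'
    simp only [hnorm] at h1
    exact (isLittleO_const_mul_left_iff (by positivity)).1 h1
  have hrate' : ∀ k : ℕ, 1 ≤ k → ‖r k‖
      ≤ β * (1 + t) * ‖w 0 - ws‖ / (γ * (k : ℝ) * √(β ^ 2 - γ ^ 2 / κ ^ 2)) := by
    intro k hk
    refine le_of_sq_le_sq ((hrate k hk).trans_eq ?_) (by positivity)
    rw [div_pow, mul_pow, mul_pow, mul_pow, mul_pow, Real.sq_sqrt (by rw [hD]; positivity)]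
  have hlow : ∀ k, -(‖ws‖ * ‖r k‖) ≤ DualSplitting.objectiveError f g (x k) xs (y k) ys :=
    fun k => DualSplitting.neg_mul_norm_le_objectiveError hopt.subgrad_f hopt.subgrad_g hfeas
      (hx k).1 (hy k).1
  have hup : ∀ k, DualSplitting.objectiveError f g (x k) xs (y k) ys
      ≤ ‖r k‖ * (‖z₀ - zs‖ + ‖ws‖) := fun k => by
    refine (DualSplitting.objectiveError_le (hx k) (hy k) hfeas hzs hopt.subgrad_f.1
      hopt.subgrad_g.1).trans (mul_le_mul_of_nonneg_left (add_le_add_left ?_ _) (norm_nonneg _))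
    have h1 := hfejer (k + 1)
    have e0 : w 0 + γ • (B (y 0) - b) = z₀ := by rw [hadmm.w_zero_eq]; abel
    have e1 := horb.w_add_Q_succ k
    rwa [e0, e1, hzs, add_sub_cancel] at h1
  refine ⟨hrate, hlittle, fun k => ⟨(hx k).1, (hy k).1⟩, fun k hk => ⟨?_, ?_⟩, ?_⟩
  · refine le_trans ?_ (hlow k)
    rw [neg_div, neg_le_neg_iff]
    refine (mul_le_mul_of_nonneg_left (hrate' k hk) (norm_nonneg ws)).trans_eq ?_
    ring
  · refine (hup k).trans
      ((mul_le_mul_of_nonneg_right (hrate' k hk) (by positivity)).trans_eq ?_)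
    ring
  · have hr1 : (fun k : ℕ => ‖r k‖) =o[atTop] fun k : ℕ => 1 / (k : ℝ) := by
      refine IsLittleO.of_pow (n := 2) ?_ two_ne_zero
      simpa [Pi.pow_def] using hlittle
    refine IsBigO.trans_isLittleO (IsBigO.of_bound (‖z₀ - zs‖ + ‖ws‖) ?_) hr1
    refine Eventually.of_forall fun k => ?_
    rw [Real.norm_eq_abs, abs_abs, Real.norm_eq_abs, abs_norm, abs_le, mul_comm]
    refine ⟨le_trans ?_ (hlow k), hup k⟩
    nlinarith [mul_nonneg (norm_nonneg (r k)) (norm_nonneg (z₀ - zs))]
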